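/- Let $\mathcal{G}$ be the planar Galilean conformal algebra, i.e. the complex Lie algebra with basis $\{L_m, H_m, I_m, J_m \mid m\in\mathbb{Z}\}$ and, for all $m,n\in\mathbb{Z}$, brackets $$[L_n,L_m]=(m-n)L_{m+n},\quad [L_n,H_m]=mH_{m+n},\quad [L_n,I_m]=(m-n)I_{m+n},$$ $$[L_n,J_m]=(m-n)J_{m+n},\quad [H_n,I_m]=I_{m+n},\quad [H_n,J_m]=-J_{m+n},$$ where all brackets of basis vectors that are not determined by these and skew-symmetry are zero. A derivation of $\mathcal{G}$ is a $\mathbb{C}$-linear map $D:\mathcal{G}\to\mathcal{G}$ with $D([x,y])=[D(x),y]+[x,D(y)]$ for all $x,y\in\mathcal{G}$. A map $\Delta:\mathcal{G}\to\mathcal{G}$, not assumed linear, is a 2-local derivation if for all $x,y\in\mathcal{G}$ there is a derivation $\Delta_{x,y}$ of $\mathcal{G}$, depending on $x$ and $y$, such that $\Delta(x)=\Delta_{x,y}(x)$ and $\Delta(y)=\Delta_{x,y}(y)$. Then every 2-local derivation on $\mathcal{G}$ is a derivation. -/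

import Mathlib

noncomputable section

/-- A map `Δ : 𝔤 → 𝔤` (not assumed linear) on a Lie algebra is a 2-local derivation if for every
pair `x, y` there is a derivation of `𝔤`, depending on `x` and `y`, that agrees with `Δ` at `x`
and at `y`. -/
def IsTwoLocalDerivation (R : Type*) {𝔤 : Type*} [CommRing R] [LieRing 𝔤] [LieAlgebra R 𝔤]
    (Δ : 𝔤 → 𝔤) : Prop :=
  ∀ x y : 𝔤, ∃ D : LieDerivation R 𝔤 𝔤, Δ x = D x ∧ Δ y = D y

/-- The four families of basis vectors of the planar Galilean conformal algebra. -/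
inductive PlanarGCA.Family : Type
  | L | H | I | J

/-- The vector space underlying the planar Galilean conformal algebra: the complex vector space
with basis `L m`, `H m`, `I m`, `J m`, for `m : ℤ`. -/
def PlanarGCA : Type := (PlanarGCA.Family × ℤ) →₀ ℂ

namespace PlanarGCA

instance : AddCommGroup PlanarGCA := inferInstanceAs (AddCommGroup ((Family × ℤ) →₀ ℂ))

instance : Module ℂ PlanarGCA := inferInstanceAs (Module ℂ ((Family × ℤ) →₀ ℂ))

/-- The defining basis. -/
def basis : Module.Basis (Family × ℤ) ℂ PlanarGCA := Module.Basis.ofRepr (LinearEquiv.refl ℂ _)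

def L (m : ℤ) : PlanarGCA := basis (.L, m)

def H (m : ℤ) : PlanarGCA := basis (.H, m)

def I (m : ℤ) : PlanarGCA := basis (.I, m)

def J (m : ℤ) : PlanarGCA := basis (.J, m)

/-- The bracket of two basis vectors. -/
def basisBracket : Family × ℤ → Family × ℤ → PlanarGCA
  | (.L, n), (.L, m) => ((m : ℂ) - n) • L (m + n)
  | (.L, n), (.H, m) => (m : ℂ) • H (m + n)
  | (.L, n), (.I, m) => ((m : ℂ) - n) • I (m + n)
  | (.L, n), (.J, m) => ((m : ℂ) - n) • J (m + n)
  | (.H, n), (.L, m) => -((n : ℂ) • H (m + n))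
  | (.H, _), (.H, _) => 0
  | (.H, n), (.I, m) => I (m + n)
  | (.H, n), (.J, m) => -J (m + n)
  | (.I, n), (.L, m) => ((m : ℂ) - n) • I (m + n)
  | (.I, n), (.H, m) => -I (m + n)
  | (.I, _), (.I, _) => 0
  | (.I, _), (.J, _) => 0
  | (.J, n), (.L, m) => ((m : ℂ) - n) • J (m + n)
  | (.J, n), (.H, m) => J (m + n)
  | (.J, _), (.I, _) => 0
  | (.J, _), (.J, _) => 0

/-- The bilinear extension of `basisBracket`. -/
def bracketBilin : PlanarGCA →ₗ[ℂ] PlanarGCA →ₗ[ℂ] PlanarGCA :=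
  basis.constr ℂ fun a => basis.constr ℂ fun b => basisBracket a b

instance : Bracket PlanarGCA PlanarGCA := ⟨fun x y => bracketBilin x y⟩

theorem bracket_def (x y : PlanarGCA) : ⁅x, y⁆ = bracketBilin x y := rfl

theorem bracketBilin_basis (a b : Family × ℤ) :
    bracketBilin (basis a) (basis b) = basisBracket a b := by
  simp [bracketBilin, Module.Basis.constr_basis]

theorem basisBracket_skew (a b : Family × ℤ) : basisBracket a b = -basisBracket b a := by
  obtain ⟨s, n⟩ := a
  obtain ⟨t, m⟩ := b
  cases s <;> cases t <;> simp only [basisBracket, add_comm n m] <;> module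

theorem bracketBilin_skew (x y : PlanarGCA) : bracketBilin x y = -bracketBilin y x := by
  have h : bracketBilin = -bracketBilin.flip :=
    basis.ext fun a => basis.ext fun b => by
      simp only [LinearMap.neg_apply, LinearMap.flip_apply, bracketBilin_basis]
      exact basisBracket_skew a b
  simpa using congrArg (fun f : PlanarGCA →ₗ[ℂ] PlanarGCA →ₗ[ℂ] PlanarGCA => f x y) h

theorem bracketBilin_jacobi_basis (a b c : Family × ℤ) :
    bracketBilin (basis a) (basisBracket b c) =
      bracketBilin (basisBracket a b) (basis c) + bracketBilin (basis b) (basisBracket a c) := by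
  obtain ⟨s, n⟩ := a
  obtain ⟨t, m⟩ := b
  obtain ⟨u, k⟩ := c
  have e1 : k + m + n = k + (m + n) := add_assoc k m n
  have e2 : k + n + m = k + (m + n) := by ring
  cases s <;> cases t <;> cases u <;>
    simp only [basisBracket, L, H, I, J, map_smul, map_neg, map_zero, LinearMap.smul_apply,
      LinearMap.neg_apply, LinearMap.zero_apply, bracketBilin_basis, e1, e2, Int.cast_add] <;>
    module

theorem bracketBilin_jacobi (x y z : PlanarGCA) :
    bracketBilin x (bracketBilin y z) =
      bracketBilin (bracketBilin x y) z + bracketBilin y (bracketBilin x z) := by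
  have hx : ∀ v : PlanarGCA, v ∈ Submodule.span ℂ (Set.range basis) := fun v => by
    rw [basis.span_eq]; trivial
  induction hx x using Submodule.span_induction with
  | zero => simp
  | add p q _ _ hp hq => simp only [map_add, LinearMap.add_apply, hp, hq]; abel
  | smul r p _ hp => simp only [map_smul, LinearMap.smul_apply, hp, smul_add]
  | mem p hp =>
    obtain ⟨a, rfl⟩ := hp
    induction hx y using Submodule.span_induction with
    | zero => simp
    | add p q _ _ hp hq => simp only [map_add, LinearMap.add_apply, hp, hq]; abel
    | smul r p _ hp => simp only [map_smul, LinearMap.smul_apply, hp, smul_add]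
    | mem p hp =>
      obtain ⟨b, rfl⟩ := hp
      induction hx z using Submodule.span_induction with
      | zero => simp
      | add p q _ _ hp hq => simp only [map_add, hp, hq]; abel
      | smul r p _ hp => simp only [map_smul, hp, smul_add]
      | mem p hp =>
        obtain ⟨c, rfl⟩ := hp
        simpa only [bracketBilin_basis] using bracketBilin_jacobi_basis a b c

instance : LieRing PlanarGCA where
  add_lie x y z := by simp [bracket_def]
  lie_add x y z := by simp [bracket_def]
  lie_self x := by
    have h := bracketBilin_skew x x
    rw [bracket_def]
    have h2 : (2 : ℂ) • bracketBilin x x = 0 := by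
      rw [two_smul]
      nth_rewrite 1 [h]
      exact neg_add_cancel _
    exact (smul_eq_zero.mp h2).resolve_left two_ne_zero
  leibniz_lie x y z := bracketBilin_jacobi x y z

instance : LieAlgebra ℂ PlanarGCA where
  lie_smul c x y := by simp [bracket_def]

/-- The bracket of `PlanarGCA` takes the prescribed values on the basis. -/
theorem lie_basis (a b : Family × ℤ) : ⁅basis a, basis b⁆ = basisBracket a b :=
  bracketBilin_basis a b

end PlanarGCA

end

namespace PlanarGCA

/-! Every derivation is an inner one plus a map scaling all `I m` by `r` and all `J m` by `s`
(`exists_derivation_eq_lie_add_scaling`). Subtracting a derivation that agrees with `Δ` at `L 0` and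
`L 1`, one may assume that `Δ` kills both; comparing degrees, it then kills every `L N`
(`twoLocal_L_eq_zero`).

A derivation killing `L N` is a scaling plus the bracket with a vector of degree `N`. As `x` and `Δ
x` have bounded degrees, for large `N` this bracket cannot contribute, so `Δ x` is a scaling of `x`,
with factors that may depend on `x` (`exists_twoLocal_eq_scalingMap`).

To make the factors uniform, pair `x` with the test vector `L N + I (2 * N) + J (2 * N)`: its own
factors determine the derivation up to brackets with vectors of degree at least `N`
(`exists_of_derivation_eq_scalingMap`). So they are the factors at `x` for all large `N`, and
evaluation at `I 0 + J 0` shows that they stabilize. -/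

theorem repr_L (m : ℤ) (p : Family × ℤ) [Decidable ((Family.L, m) = p)] :
    basis.repr (L m) p = if (Family.L, m) = p then 1 else 0 := by
  classical
  rw [L, Module.Basis.repr_self, Finsupp.single_apply]
theorem repr_H (m : ℤ) (p : Family × ℤ) [Decidable ((Family.H, m) = p)] :
    basis.repr (H m) p = if (Family.H, m) = p then 1 else 0 := by
  classical
  rw [H, Module.Basis.repr_self, Finsupp.single_apply]
theorem repr_I (m : ℤ) (p : Family × ℤ) [Decidable ((Family.I, m) = p)] :
    basis.repr (I m) p = if (Family.I, m) = p then 1 else 0 := by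
  classical
  rw [I, Module.Basis.repr_self, Finsupp.single_apply]
theorem repr_J (m : ℤ) (p : Family × ℤ) [Decidable ((Family.J, m) = p)] :
    basis.repr (J m) p = if (Family.J, m) = p then 1 else 0 := by
  classical
  rw [J, Module.Basis.repr_self, Finsupp.single_apply]

theorem lie_L_L (n m : ℤ) : ⁅L n, L m⁆ = ((m : ℂ) - n) • L (m + n) := lie_basis _ _
theorem lie_L_H (n m : ℤ) : ⁅L n, H m⁆ = (m : ℂ) • H (m + n) := lie_basis _ _
theorem lie_L_I (n m : ℤ) : ⁅L n, I m⁆ = ((m : ℂ) - n) • I (m + n) := lie_basis _ _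
theorem lie_L_J (n m : ℤ) : ⁅L n, J m⁆ = ((m : ℂ) - n) • J (m + n) := lie_basis _ _
theorem lie_H_L (n m : ℤ) : ⁅H n, L m⁆ = -((n : ℂ) • H (m + n)) := lie_basis _ _
theorem lie_H_H (n m : ℤ) : ⁅H n, H m⁆ = 0 := lie_basis _ _
theorem lie_H_I (n m : ℤ) : ⁅H n, I m⁆ = I (m + n) := lie_basis _ _
theorem lie_H_J (n m : ℤ) : ⁅H n, J m⁆ = -J (m + n) := lie_basis _ _
theorem lie_I_L (n m : ℤ) : ⁅I n, L m⁆ = ((m : ℂ) - n) • I (m + n) := lie_basis _ _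
theorem lie_I_H (n m : ℤ) : ⁅I n, H m⁆ = -I (m + n) := lie_basis _ _
theorem lie_I_I (n m : ℤ) : ⁅I n, I m⁆ = 0 := lie_basis _ _
theorem lie_I_J (n m : ℤ) : ⁅I n, J m⁆ = 0 := lie_basis _ _
theorem lie_J_L (n m : ℤ) : ⁅J n, L m⁆ = ((m : ℂ) - n) • J (m + n) := lie_basis _ _
theorem lie_J_H (n m : ℤ) : ⁅J n, H m⁆ = J (m + n) := lie_basis _ _
theorem lie_J_I (n m : ℤ) : ⁅J n, I m⁆ = 0 := lie_basis _ _
theorem lie_J_J (n m : ℤ) : ⁅J n, J m⁆ = 0 := lie_basis _ _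

attribute [simp] repr_L repr_H repr_I repr_J lie_L_L lie_L_H lie_L_I lie_L_J lie_H_L lie_H_H
  lie_H_I lie_H_J lie_I_L lie_I_H lie_I_I lie_I_J lie_J_L lie_J_H lie_J_I lie_J_J

theorem ext_repr {x y : PlanarGCA}
    (hL : ∀ m, basis.repr x (.L, m) = basis.repr y (.L, m))
    (hH : ∀ m, basis.repr x (.H, m) = basis.repr y (.H, m))
    (hI : ∀ m, basis.repr x (.I, m) = basis.repr y (.I, m))
    (hJ : ∀ m, basis.repr x (.J, m) = basis.repr y (.J, m)) : x = y := by
  apply basis.repr.injective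
  ext ⟨f, m⟩
  cases f
  exacts [hL m, hH m, hI m, hJ m]

/-- Linear maps that agree on the four families of basis vectors are equal. -/
theorem linearMap_ext {V : Type*} [AddCommMonoid V] [Module ℂ V] {f g : PlanarGCA →ₗ[ℂ] V}
    (hL : ∀ m, f (L m) = g (L m)) (hH : ∀ m, f (H m) = g (H m))
    (hI : ∀ m, f (I m) = g (I m)) (hJ : ∀ m, f (J m) = g (J m)) : f = g := by
  refine basis.ext fun ⟨a, m⟩ => ?_
  cases a
  exacts [hL m, hH m, hI m, hJ m]

/-- The linear functional taking the coefficient of a basis vector. -/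
noncomputable def coefficient (p : Family × ℤ) : PlanarGCA →ₗ[ℂ] ℂ := basis.coord p

theorem coefficient_apply (p : Family × ℤ) (x : PlanarGCA) :
    coefficient p x = basis.repr x p := rfl

/-- The linear map `x ↦ ⁅x, v⁆`. -/
noncomputable def rightBracket (v : PlanarGCA) : PlanarGCA →ₗ[ℂ] PlanarGCA := bracketBilin.flip v

theorem rightBracket_apply (v x : PlanarGCA) : rightBracket v x = ⁅x, v⁆ := rfl

/-! ### Brackets with `L N` and its centralizer -/

theorem repr_lie_L_of_linear {N m : ℤ} {a : Family} {c : ℂ}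
    (h : (coefficient (a, m)) ∘ₗ (rightBracket (L N)) = c • coefficient (a, m - N))
    (u : PlanarGCA) : basis.repr ⁅u, L N⁆ (a, m) = c * basis.repr u (a, m - N) :=
  congrArg (fun f : PlanarGCA →ₗ[ℂ] ℂ => f u) h

theorem repr_lie_L_L (u : PlanarGCA) (N m : ℤ) :
    basis.repr ⁅u, L N⁆ (.L, m) = (2 * N - m) * basis.repr u (.L, m - N) := by
  classical
  refine repr_lie_L_of_linear (linearMap_ext ?_ ?_ ?_ ?_) u <;> intro k <;>
    simp [coefficient_apply, rightBracket_apply, eq_sub_iff_add_eq, add_comm N k]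
  split_ifs with h
  · subst h; push_cast; ring
  · rfl

theorem repr_lie_L_H (u : PlanarGCA) (N m : ℤ) :
    basis.repr ⁅u, L N⁆ (.H, m) = (N - m) * basis.repr u (.H, m - N) := by
  classical
  refine repr_lie_L_of_linear (linearMap_ext ?_ ?_ ?_ ?_) u <;> intro k <;>
    simp [coefficient_apply, rightBracket_apply, eq_sub_iff_add_eq, add_comm N k]
  split_ifs with h
  · subst h; push_cast; ring
  · simp

theorem repr_lie_L_I (u : PlanarGCA) (N m : ℤ) :
    basis.repr ⁅u, L N⁆ (.I, m) = (2 * N - m) * basis.repr u (.I, m - N) := by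
  classical
  refine repr_lie_L_of_linear (linearMap_ext ?_ ?_ ?_ ?_) u <;> intro k <;>
    simp [coefficient_apply, rightBracket_apply, eq_sub_iff_add_eq, add_comm N k]
  split_ifs with h
  · subst h; push_cast; ring
  · rfl

theorem repr_lie_L_J (u : PlanarGCA) (N m : ℤ) :
    basis.repr ⁅u, L N⁆ (.J, m) = (2 * N - m) * basis.repr u (.J, m - N) := by
  classical
  refine repr_lie_L_of_linear (linearMap_ext ?_ ?_ ?_ ?_) u <;> intro k <;>
    simp [coefficient_apply, rightBracket_apply, eq_sub_iff_add_eq, add_comm N k]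
  split_ifs with h
  · subst h; push_cast; ring
  · rfl

/-- The centralizer of `L N`. -/
theorem eq_of_lie_L_eq_zero {u : PlanarGCA} {N : ℤ} (h : ⁅u, L N⁆ = 0) :
    ∃ a b c d : ℂ, u = a • L N + b • H 0 + c • I N + d • J N := by
  classical
  refine ⟨basis.repr u (.L, N), basis.repr u (.H, 0), basis.repr u (.I, N),
    basis.repr u (.J, N), ?_⟩
  apply ext_repr <;> intro m
  · have := repr_lie_L_L u N (m + N)
    simp [h] at this
    by_cases hm : N = m
    · simp [hm]
    · have h2 : (2 * N - (m + N) : ℂ) ≠ 0 := by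
        intro h; apply hm; exact_mod_cast (by linear_combination h : (N : ℂ) = m)
      simp_all
  · have := repr_lie_L_H u N (m + N)
    simp [h] at this
    by_cases hm : 0 = m
    · simp [← hm]
    · have h2 : (N - (m + N) : ℂ) ≠ 0 := by
        intro h; apply hm; exact_mod_cast (by linear_combination h : (0 : ℂ) = m)
      simp_all
  · have := repr_lie_L_I u N (m + N)
    simp [h] at this
    by_cases hm : N = m
    · simp [hm]
    · have h2 : (2 * N - (m + N) : ℂ) ≠ 0 := by
        intro h; apply hm; exact_mod_cast (by linear_combination h : (N : ℂ) = m)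
      simp_all
  · have := repr_lie_L_J u N (m + N)
    simp [h] at this
    by_cases hm : N = m
    · simp [hm]
    · have h2 : (2 * N - (m + N) : ℂ) ≠ 0 := by
        intro h; apply hm; exact_mod_cast (by linear_combination h : (N : ℂ) = m)
      simp_all

/-! ### Scaling derivations -/

/-- The scalar by which `scaling r s` acts on a family. -/
def scalingFactor (r s : ℂ) : Family → ℂ
  | .L => 0
  | .H => 0
  | .I => r
  | .J => s

noncomputable def scalingMap (r s : ℂ) : PlanarGCA →ₗ[ℂ] PlanarGCA :=
  basis.constr ℂ fun p => scalingFactor r s p.1 • basis p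

theorem scalingMap_basis (r s : ℂ) (p : Family × ℤ) :
    scalingMap r s (basis p) = scalingFactor r s p.1 • basis p := by
  simp [scalingMap, Module.Basis.constr_basis]

theorem scalingMap_L (r s : ℂ) (m : ℤ) : scalingMap r s (L m) = 0 :=
  (scalingMap_basis r s (.L, m)).trans (zero_smul _ _)
theorem scalingMap_H (r s : ℂ) (m : ℤ) : scalingMap r s (H m) = 0 :=
  (scalingMap_basis r s (.H, m)).trans (zero_smul _ _)
theorem scalingMap_I (r s : ℂ) (m : ℤ) : scalingMap r s (I m) = r • I m :=
  scalingMap_basis r s (.I, m)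
theorem scalingMap_J (r s : ℂ) (m : ℤ) : scalingMap r s (J m) = s • J m :=
  scalingMap_basis r s (.J, m)

attribute [simp] scalingMap_L scalingMap_H scalingMap_I scalingMap_J

theorem scalingMap_leibniz (r s : ℂ) (x y : PlanarGCA) :
    scalingMap r s ⁅x, y⁆ = ⁅x, scalingMap r s y⁆ - ⁅y, scalingMap r s x⁆ := by
  have h : bracketBilin.compr₂ (scalingMap r s) =
      bracketBilin.compl₂ (scalingMap r s) - (bracketBilin.compl₂ (scalingMap r s)).flip := by
    apply linearMap_ext <;> intro n <;> apply linearMap_ext <;> intro m <;>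
      simp [← bracket_def, add_comm n m]
    all_goals module
  exact congrArg (fun f : PlanarGCA →ₗ[ℂ] PlanarGCA →ₗ[ℂ] PlanarGCA => f x y) h

/-- The derivation that multiplies every `I m` by `r` and every `J m` by `s`, and kills the
other two families. -/
noncomputable def scaling (r s : ℂ) : LieDerivation ℂ PlanarGCA PlanarGCA where
  toLinearMap := scalingMap r s
  leibniz' := scalingMap_leibniz r s

theorem scaling_apply (r s : ℂ) (x : PlanarGCA) : scaling r s x = scalingMap r s x := rfl

/-! ### Classification of derivations -/

theorem repr_lie_L_zero (x : PlanarGCA) (p : Family × ℤ) :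
    basis.repr ⁅x, L 0⁆ p = -(p.2 * basis.repr x p) := by
  obtain ⟨a, m⟩ := p
  cases a
  · simp [repr_lie_L_L]
  · simp [repr_lie_L_H]
  · simp [repr_lie_L_I]
  · simp [repr_lie_L_J]

theorem lie_L_zero_basis (p : Family × ℤ) : ⁅L 0, basis p⁆ = (p.2 : ℂ) • basis p := by
  obtain ⟨a, m⟩ := p
  have h : ⁅L 0, basis (a, m)⁆ = basisBracket (.L, 0) (a, m) := lie_basis _ _
  rw [h]
  cases a <;> simp [basisBracket, L, H, I, J]

/-- A homogeneous vector is a combination of the four basis vectors of its degree. -/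
theorem eq_of_homogeneous {v : PlanarGCA} {m : ℤ} (h : ∀ q, q.2 ≠ m → basis.repr v q = 0) :
    ∃ a b c d : ℂ, v = a • L m + b • H m + c • I m + d • J m := by
  classical
  refine ⟨basis.repr v (.L, m), basis.repr v (.H, m), basis.repr v (.I, m),
    basis.repr v (.J, m), ?_⟩
  apply ext_repr <;> intro k <;> by_cases hk : m = k
  all_goals first
    | (subst hk; simp)
    | simp [hk, h (_, k) (fun e => hk e.symm)]

section Derivation

variable (D : LieDerivation ℂ PlanarGCA PlanarGCA)

/-- Apply `D` to the eigenvector equation of `basis p` under `ad (L 0)` and compare coefficients at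
`q`. -/
theorem derivation_L_zero_repr (p q : Family × ℤ) :
    (p.2 - q.2 : ℂ) * basis.repr (D (basis p)) q =
      -basis.repr ⁅basis p, D (L 0)⁆ q := by
  have h := D.apply_lie_eq_sub (L 0) (basis p)
  rw [lie_L_zero_basis, map_smul, ← lie_skew (L 0) (D (basis p))] at h
  have h2 := congrArg (fun v => basis.repr v q) h
  simp only [map_smul, map_sub, map_neg, Finsupp.smul_apply, Finsupp.sub_apply,
    Finsupp.neg_apply, repr_lie_L_zero, smul_eq_mul] at h2
  linear_combination h2

theorem derivation_L_zero_eq_zero (h : ∀ q : Family × ℤ, q.2 ≠ 0 → basis.repr (D (L 0)) q = 0) :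
    D (L 0) = 0 := by
  classical
  obtain ⟨a, b, c, d, hv⟩ := eq_of_homogeneous h
  -- With equal degrees the left side vanishes. `L 1` detects `a`, `c`, `d` but not `b`, since it
  -- commutes with `H 0`; `I 0` detects `b`.
  have h1 := derivation_L_zero_repr D (.L, 1) (.L, 1)
  have h2 := derivation_L_zero_repr D (.L, 1) (.I, 1)
  have h3 := derivation_L_zero_repr D (.L, 1) (.J, 1)
  have h4 := derivation_L_zero_repr D (.I, 0) (.I, 0)
  rw [hv] at h1 h2 h3 h4
  change _ = -basis.repr ⁅L 1, _⁆ _ at h1 h2 h3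
  change _ = -basis.repr ⁅I 0, _⁆ _ at h4
  simp at h1 h2 h3 h4
  simp [hv, ← h1, ← h2, ← h3, ← h4]

theorem exists_derivation_apply_homogeneous (h : D (L 0) = 0) (p : Family × ℤ) :
    ∃ a b c d : ℂ, D (basis p) = a • L p.2 + b • H p.2 + c • I p.2 + d • J p.2 := by
  refine eq_of_homogeneous fun q hq => ?_
  have h1 := derivation_L_zero_repr D p q
  rw [h, lie_zero] at h1
  have h2 : (p.2 - q.2 : ℂ) ≠ 0 := by
    rw [sub_ne_zero]
    exact_mod_cast hq.symm
  simpa [h2] using h1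

/-- A derivation that kills `L 0` and maps `L 1` to a multiple of `H 1` kills `L 1`. -/
theorem derivation_L_one_eq_zero (h : D (L 0) = 0) {t : ℂ} (h1 : D (L 1) = t • H 1) :
    D (L 1) = 0 := by
  classical
  obtain ⟨a, b, c, d, hv⟩ := exists_derivation_apply_homogeneous D h (.I, 1)
  change D (I 1) = _ at hv
  -- `L 1` and `I 1` commute, and `⁅L 1, D (I 1)⁆` has no `I 2` component to cancel `t • I 2`.
  have e := D.apply_lie_eq_sub (L 1) (I 1)
  rw [hv, h1] at e
  have e2 := congrArg (fun v => basis.repr v (.I, 2)) e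
  simp at e2
  simp [h1, e2]

theorem derivation_L_neg_one_eq_zero (h : D (L 0) = 0) (h1 : D (L 1) = 0) : D (L (-1)) = 0 := by
  classical
  obtain ⟨a, b, c, d, hv⟩ := exists_derivation_apply_homogeneous D h (.L, -1)
  change D (L (-1)) = _ at hv
  have e := D.apply_lie_eq_sub (L (-1)) (L 1)
  rw [hv, h1] at e
  simp [h] at e
  have eL := congrArg (fun v => basis.repr v (.L, 0)) e
  have eH := congrArg (fun v => basis.repr v (.H, 0)) e
  have eI := congrArg (fun v => basis.repr v (.I, 0)) e
  have eJ := congrArg (fun v => basis.repr v (.J, 0)) e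
  simp at eL eH eI eJ
  norm_num at eL eH eI eJ
  simp [hv, eL, ← eH, eI, eJ]

/-- On degree `m`, `ad (L n)` multiplies the `L`, `I`, `J` components by `m - n` and the `H`
component by `m`, so it is injective there. -/
theorem derivation_L_step {m n : ℤ} (h : D (L 0) = 0) (hn : D (L n) = 0)
    (hmn : D (L (m + n)) = 0) (h1 : m ≠ n) (h0 : m ≠ 0) : D (L m) = 0 := by
  classical
  obtain ⟨a, b, c, d, hv⟩ := exists_derivation_apply_homogeneous D h (.L, m)
  change D (L m) = _ at hv
  have e := D.apply_lie_eq_sub (L n) (L m)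
  rw [hv, hn] at e
  simp [hmn] at e
  have h1' : (m - n : ℂ) ≠ 0 := by rw [sub_ne_zero]; exact_mod_cast h1
  have h0' : (m : ℂ) ≠ 0 := by exact_mod_cast h0
  have eL := congrArg (fun v => basis.repr v (.L, m + n)) e
  have eH := congrArg (fun v => basis.repr v (.H, m + n)) e
  have eI := congrArg (fun v => basis.repr v (.I, m + n)) e
  have eJ := congrArg (fun v => basis.repr v (.J, m + n)) e
  simp [h1', h0'] at eL eH eI eJ
  simp [hv, eL, eH, eI, eJ]

theorem derivation_L_eq_zero (h : D (L 0) = 0) (h1 : D (L 1) = 0) (m : ℤ) : D (L m) = 0 := by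
  have h' := derivation_L_neg_one_eq_zero D h h1
  induction m using Int.induction_on with
  | zero => exact h
  | succ k ih =>
    exact derivation_L_step D (n := -1) h h' (by simpa using ih) (by omega) (by omega)
  | pred k ih =>
    exact derivation_L_step D (n := 1) h h1 (by simpa using ih) (by omega) (by omega)

theorem exists_derivation_apply_zero (h : ∀ m, D (L m) = 0) :
    ∃ r s : ℂ, D (H 0) = 0 ∧ D (I 0) = r • I 0 ∧ D (J 0) = s • J 0 := by
  classical
  obtain ⟨a, b, c, d, hH⟩ := exists_derivation_apply_homogeneous D (h 0) (.H, 0)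
  obtain ⟨a', b', c', d', hI⟩ := exists_derivation_apply_homogeneous D (h 0) (.I, 0)
  obtain ⟨a'', b'', c'', d'', hJ⟩ := exists_derivation_apply_homogeneous D (h 0) (.J, 0)
  change D (H 0) = _ at hH
  change D (I 0) = _ at hI
  change D (J 0) = _ at hJ
  have e := D.apply_lie_eq_sub (L 1) (H 0)
  rw [hH, h 1] at e
  have eL := congrArg (fun v => basis.repr v (.L, 1)) e
  have eI := congrArg (fun v => basis.repr v (.I, 1)) e
  have eJ := congrArg (fun v => basis.repr v (.J, 1)) e
  simp at eL eI eJ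
  subst eL eI eJ
  -- `I 0` and `J 0` are eigenvectors of `ad (H 0)` for `1` and `-1`; the `I 0` coefficient also
  -- forces `D (H 0) = 0`.
  have f := D.apply_lie_eq_sub (H 0) (I 0)
  rw [hH, lie_H_I, zero_add, hI] at f
  have fL := congrArg (fun v => basis.repr v (.L, 0)) f
  have fH := congrArg (fun v => basis.repr v (.H, 0)) f
  have fI := congrArg (fun v => basis.repr v (.I, 0)) f
  have fJ := congrArg (fun v => basis.repr v (.J, 0)) f
  simp at fL fH fI fJ
  have g := D.apply_lie_eq_sub (H 0) (J 0)
  rw [hH, lie_H_J, zero_add, map_neg, hJ] at g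
  have gL := congrArg (fun v => basis.repr v (.L, 0)) g
  have gH := congrArg (fun v => basis.repr v (.H, 0)) g
  have gI := congrArg (fun v => basis.repr v (.I, 0)) g
  have gJ := congrArg (fun v => basis.repr v (.J, 0)) g
  simp at gL gH gI gJ
  have fJ' : d' = 0 := by linear_combination fJ / 2
  have gI' : c'' = 0 := by linear_combination -gI / 2
  refine ⟨c', d'', ?_, ?_, ?_⟩
  · simp [hH, fI]
  · simp [hI, fL, fH, fJ']
  · simp [hJ, gL, gH, gI']

/-- A derivation that kills every `L m` is a scaling. -/
theorem derivation_eq_scaling (h : ∀ m, D (L m) = 0) :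
    ∃ r s : ℂ, ∀ x, D x = scalingMap r s x := by
  classical
  obtain ⟨r, s, hH, hI, hJ⟩ := exists_derivation_apply_zero D h
  have hIm (m : ℤ) : D (I m) = r • I m := by
    by_cases hm : m = 0
    · rw [hm, hI]
    · have e := D.apply_lie_eq_sub (L m) (I 0)
      rw [hI, h m] at e
      simp [smul_comm r] at e
      exact smul_right_injective _ (Int.cast_ne_zero.mpr hm : (m : ℂ) ≠ 0) e
  have hJm (m : ℤ) : D (J m) = s • J m := by
    by_cases hm : m = 0
    · rw [hm, hJ]
    · have e := D.apply_lie_eq_sub (L m) (J 0)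
      rw [hJ, h m] at e
      simp [smul_comm s] at e
      exact smul_right_injective _ (Int.cast_ne_zero.mpr hm : (m : ℂ) ≠ 0) e
  have hHm (m : ℤ) : D (H m) = 0 := by
    obtain ⟨a, b, c, d, hv⟩ := exists_derivation_apply_homogeneous D (h 0) (.H, m)
    change D (H m) = _ at hv
    by_cases hm : m = 0
    · rw [hm, hH]
    have g := D.apply_lie_eq_sub (L (-m)) (H m)
    rw [hv, h (-m), lie_L_H] at g
    simp [hH] at g
    have hm' : (m : ℂ) ≠ 0 := by exact_mod_cast hm
    have gL := congrArg (fun v => basis.repr v (.L, 0)) g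
    have gH := congrArg (fun v => basis.repr v (.H, 0)) g
    have gI := congrArg (fun v => basis.repr v (.I, 0)) g
    have gJ := congrArg (fun v => basis.repr v (.J, 0)) g
    simp [hm, ← two_mul] at gL gH gI gJ
    simp [hv, gL, gH, gI, gJ]
  refine ⟨r, s, fun x => ?_⟩
  have := linearMap_ext (f := (D : PlanarGCA →ₗ[ℂ] PlanarGCA)) (g := scalingMap r s)
    (by simp [h]) (by simp [hHm]) (by simp [hIm]) (by simp [hJm])
  exact congrArg (fun f : PlanarGCA →ₗ[ℂ] PlanarGCA => f x) this

/-- Every derivation is the sum of an inner derivation and a scaling. -/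
theorem exists_derivation_eq_lie_add_scaling :
    ∃ (u : PlanarGCA) (r s : ℂ), ∀ x, D x = ⁅u, x⁆ + scalingMap r s x := by
  classical
  -- Bracketing with `L 0` multiplies degree `k` by `-k`, so this solves `⁅u₁, L 0⁆ = D (L 0)` away
  -- from degree `0`, where division by zero gives `0`.
  let f : (Family × ℤ) →₀ ℂ := Finsupp.onFinset (basis.repr (D (L 0))).support
    (fun p => -(basis.repr (D (L 0)) p / p.2)) (fun p hp => by
      rw [Finsupp.mem_support_iff]
      rintro h
      simp [h] at hp)
  let u₁ : PlanarGCA := basis.repr.symm f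
  let D₁ := D - LieDerivation.ad ℂ PlanarGCA u₁
  have h₁ : D₁ (L 0) = 0 := by
    refine derivation_L_zero_eq_zero D₁ fun q hq => ?_
    have hq' : (q.2 : ℂ) ≠ 0 := by exact_mod_cast hq
    simp [D₁, repr_lie_L_zero, u₁, f]
    field_simp
    ring
  obtain ⟨a, b, c, d, hv⟩ := exists_derivation_apply_homogeneous D₁ h₁ (.L, 1)
  change D₁ (L 1) = _ at hv
  -- `ad u₂` still kills `L 0` and removes all of `D₁ (L 1)` except the `H 1` term.
  let u₂ : PlanarGCA := a • L 0 + c • I 0 + d • J 0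
  let D₂ := D₁ - LieDerivation.ad ℂ PlanarGCA u₂
  have h₂ : D₂ (L 0) = 0 := by simp [D₂, h₁, u₂]
  have h₂' : D₂ (L 1) = b • H 1 := by
    simp [D₂, hv, u₂]
  obtain ⟨r, s, h⟩ := derivation_eq_scaling D₂
    (derivation_L_eq_zero D₂ h₂ (derivation_L_one_eq_zero D₂ h₂ h₂'))
  refine ⟨u₁ + u₂, r, s, fun x => ?_⟩
  rw [← h x]
  simp [D₂, D₁]

end Derivation

theorem repr_scalingMap (r s : ℂ) (x : PlanarGCA) (p : Family × ℤ) :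
    basis.repr (scalingMap r s x) p = scalingFactor r s p.1 * basis.repr x p := by
  classical
  have h : coefficient p ∘ₗ scalingMap r s = scalingFactor r s p.1 • coefficient p := by
    refine basis.ext fun q => ?_
    simp [scalingMap_basis, coefficient_apply, Finsupp.single_apply]
    split_ifs with h
    · rw [h]
    · rfl
  exact congrArg (fun f : PlanarGCA →ₗ[ℂ] ℂ => f x) h

theorem lie_scalingMap_I (r s : ℂ) (x : PlanarGCA) (k : ℤ) : ⁅scalingMap r s x, I k⁆ = 0 := by
  have h : rightBracket (I k) ∘ₗ scalingMap r s = 0 := by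
    apply linearMap_ext <;> simp [rightBracket_apply]
  exact congrArg (fun f : PlanarGCA →ₗ[ℂ] PlanarGCA => f x) h

theorem lie_scalingMap_J (r s : ℂ) (x : PlanarGCA) (k : ℤ) : ⁅scalingMap r s x, J k⁆ = 0 := by
  have h : rightBracket (J k) ∘ₗ scalingMap r s = 0 := by
    apply linearMap_ext <;> simp [rightBracket_apply]
  exact congrArg (fun f : PlanarGCA →ₗ[ℂ] PlanarGCA => f x) h

/-- `ad (H 0)` is itself the scaling by `1` and `-1`, so `H 0` terms can be absorbed into the
factors. -/
theorem smul_lie_H_zero_add_scalingMap (b r s : ℂ) (x : PlanarGCA) :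
    b • ⁅H 0, x⁆ + scalingMap r s x = scalingMap (b + r) (-b + s) x := by
  have h : b • bracketBilin (H 0) + scalingMap r s = scalingMap (b + r) (-b + s) := by
    apply linearMap_ext <;> intro m <;> simp [← bracket_def, add_smul]
  exact congrArg (fun f : PlanarGCA →ₗ[ℂ] PlanarGCA => f x) h

/-! ### Degree filtration -/

/-- The subspace spanned by the basis vectors of degree at least `k`. -/
noncomputable def degreeGE (k : ℤ) : Submodule ℂ PlanarGCA :=
  Submodule.span ℂ (basis '' {p | k ≤ p.2})

theorem basis_mem_degreeGE {k : ℤ} {p : Family × ℤ} (h : k ≤ p.2) : basis p ∈ degreeGE k :=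
  Submodule.subset_span ⟨p, h, rfl⟩

theorem mem_degreeGE {k : ℤ} {x : PlanarGCA} :
    x ∈ degreeGE k ↔ ∀ p : Family × ℤ, p.2 < k → basis.repr x p = 0 := by
  rw [degreeGE, Module.Basis.mem_span_image]
  constructor
  · intro h p hp
    by_contra h0
    exact absurd (h (Finsupp.mem_support_iff.mpr h0)) (not_le.mpr hp)
  · intro h p hp
    by_contra h0
    exact Finsupp.mem_support_iff.mp hp (h p (not_le.mp h0))

theorem lie_mem_degreeGE {j k : ℤ} {u x : PlanarGCA} (hu : u ∈ degreeGE j)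
    (hx : x ∈ degreeGE k) : ⁅u, x⁆ ∈ degreeGE (j + k) := by
  have h := Submodule.apply_mem_map₂ bracketBilin hu hx
  rw [degreeGE, degreeGE, Submodule.map₂_span_span] at h
  refine Submodule.span_le.mpr ?_ h
  rintro _ ⟨_, ⟨⟨a, n⟩, hn, rfl⟩, _, ⟨⟨b, m⟩, hm, rfl⟩, rfl⟩
  have hmem (f : Family) : basis (f, m + n) ∈ degreeGE (j + k) :=
    basis_mem_degreeGE (by simp only [Set.mem_ofPred_eq] at hn hm; simp only; omega)
  simp only [bracketBilin_basis, SetLike.mem_coe]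
  cases a <;> cases b <;>
    simp only [basisBracket, L, H, I, J, zero_mem, neg_mem_iff, hmem, Submodule.smul_mem]

theorem exists_degree_bound (x : PlanarGCA) :
    ∃ B : ℤ, ∀ p : Family × ℤ, B < |p.2| → basis.repr x p = 0 := by
  classical
  obtain ⟨B, hB⟩ := ((basis.repr x).support.image fun p => |p.2|).exists_le
  refine ⟨B, fun p hp => ?_⟩
  by_contra h
  exact absurd (hB _ (Finset.mem_image_of_mem _ (Finsupp.mem_support_iff.mpr h))) (not_le.mpr hp)

/-- Brackets with elements of large degree do not interfere with a scaling. -/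
theorem exists_forall_eq_scalingMap (x y : PlanarGCA) :
    ∃ K : ℤ, ∀ N, K ≤ N → ∀ u ∈ degreeGE N, ∀ r s : ℂ,
      y = ⁅u, x⁆ + scalingMap r s x → y = scalingMap r s x := by
  obtain ⟨B, hB⟩ := exists_degree_bound x
  obtain ⟨C, hC⟩ := exists_degree_bound y
  -- Then `⁅u, x⁆` lives in degrees above `max B C`, where `x` and `y` vanish.
  refine ⟨B + max B C + 1, fun N hN u hu r s h => ?_⟩
  have hx : x ∈ degreeGE (-B) := mem_degreeGE.mpr fun p hp => hB p (by
    have := neg_abs_le p.2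
    omega)
  have hux := mem_degreeGE.mp (lie_mem_degreeGE hu hx)
  refine basis.repr.injective (Finsupp.ext fun p => ?_)
  by_cases hp : p.2 ≤ max B C
  · have h' := congrArg (fun v => basis.repr v p) h
    simpa [hux p (by omega)] using h'
  · have h' := le_abs_self p.2
    rw [hC p (by omega), repr_scalingMap, hB p (by omega), mul_zero]

theorem L_mem_degreeGE {k m : ℤ} (h : k ≤ m) : L m ∈ degreeGE k := basis_mem_degreeGE h
theorem I_mem_degreeGE {k m : ℤ} (h : k ≤ m) : I m ∈ degreeGE k := basis_mem_degreeGE h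
theorem J_mem_degreeGE {k m : ℤ} (h : k ≤ m) : J m ∈ degreeGE k := basis_mem_degreeGE h

theorem combination_mem_degreeGE (a c d : ℂ) (N : ℤ) :
    a • L N + c • I N + d • J N ∈ degreeGE N :=
  add_mem (add_mem (Submodule.smul_mem _ _ (L_mem_degreeGE le_rfl))
    (Submodule.smul_mem _ _ (I_mem_degreeGE le_rfl)))
    (Submodule.smul_mem _ _ (J_mem_degreeGE le_rfl))

/-! ### Derivations with prescribed values on test vectors -/

/-- The derivations that kill `L N`. -/
theorem exists_of_derivation_L_eq_zero {D : LieDerivation ℂ PlanarGCA PlanarGCA} {N : ℤ}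
    (h : D (L N) = 0) :
    ∃ a c d r s : ℂ, ∀ x, D x = ⁅a • L N + c • I N + d • J N, x⁆ + scalingMap r s x := by
  obtain ⟨u, r, s, hD⟩ := exists_derivation_eq_lie_add_scaling D
  rw [hD, scalingMap_L, add_zero] at h
  obtain ⟨a, b, c, d, rfl⟩ := eq_of_lie_L_eq_zero h
  refine ⟨a, c, d, b + r, -b + s, fun x => ?_⟩
  rw [hD, ← smul_lie_H_zero_add_scalingMap]
  simp only [add_lie, smul_lie]
  abel

/-- A derivation that acts on `L N + I (2 * N) + J (2 * N)` as a scaling is this scaling up to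
brackets with elements of large degree. -/
theorem exists_of_derivation_eq_scalingMap {D : LieDerivation ℂ PlanarGCA PlanarGCA} {N : ℤ}
    (hN : 0 < N) {α β : ℂ} (h : D (L N + I (2 * N) + J (2 * N)) =
      scalingMap α β (L N + I (2 * N) + J (2 * N))) :
    ∃ u ∈ degreeGE N, ∀ x, D x = ⁅u, x⁆ + scalingMap α β x := by
  classical
  obtain ⟨u, r, s, hD⟩ := exists_derivation_eq_lie_add_scaling D
  rw [hD] at h
  simp only [map_add, scalingMap_L, scalingMap_I, scalingMap_J, zero_add, lie_add] at h
  -- `w` is the projection of `u` to the span of the `I` and `J` families. Since the projection is a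
  -- derivation, applying it to `h` and subtracting isolates `⁅u - w, L N⁆`.
  set w := scalingMap 1 1 u with hw
  have h1 := congrArg (scalingMap 1 1) h
  simp only [map_add, scalingMap_leibniz, scalingMap_L, scalingMap_I, scalingMap_J, map_smul,
    one_smul, lie_zero, ← hw] at h1
  have hwI (k : ℤ) : ⁅w, I k⁆ = 0 := lie_scalingMap_I _ _ _ _
  have hwJ (k : ℤ) : ⁅w, J k⁆ = 0 := lie_scalingMap_J _ _ _ _
  rw [← lie_skew (L N) w, ← lie_skew (I _) w, ← lie_skew (J _) w, hwI, hwJ] at h1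
  have h2 : ⁅u - w, L N⁆ = 0 := by
    rw [sub_lie]
    linear_combination (norm := module) h - h1
  obtain ⟨a, b, c, d, hu⟩ := eq_of_lie_L_eq_zero h2
  have hu' : u = a • L N + b • H 0 + c • I N + d • J N + w := by
    rw [← hu]
    abel
  have h3 := h
  rw [hu'] at h3
  simp [hwI, hwJ] at h3
  have hN' : N ≠ 0 := hN.ne'
  -- Degree `2 * N` is chosen because no bracket with `L N` has an `I (2 * N)` or `J (2 * N)`
  -- component.
  have e1 : b + r = α := by
    have := congrArg (fun v => basis.repr v (.I, 2 * N)) h3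
    simp [repr_lie_L_I, hN', ← two_mul] at this
    exact this
  have e2 : -b + s = β := by
    have := congrArg (fun v => basis.repr v (.J, 2 * N)) h3
    simp [repr_lie_L_J, hN', ← two_mul] at this
    exact this
  subst e1 e2
  -- What remains of `h3` sits in the `I` and `J` families: `⁅w, L N⁆` cancels the `a`-multiples of
  -- `I (3 * N)` and `J (3 * N)`.
  have h4 : ⁅w - a • (I (2 * N) + J (2 * N)), L N⁆ = 0 := by
    simp [add_comm N (2 * N)]
    simp [smul_smul] at h3
    linear_combination (norm := module) h3
  obtain ⟨a', b', c', d', hw'⟩ := eq_of_lie_L_eq_zero h4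
  have hb : b' = 0 := by
    have := congrArg (fun v => basis.repr v (.H, 0)) hw'
    simp [hw, repr_scalingMap, scalingFactor] at this
    exact this.symm
  subst hb
  refine ⟨a • L N + c • I N + d • J N + w, ?_, fun x => ?_⟩
  · rw [sub_eq_iff_eq_add.mp hw']
    simp only [zero_smul, add_zero]
    exact add_mem (combination_mem_degreeGE a c d N) (add_mem
      (combination_mem_degreeGE a' c' d' N) (Submodule.smul_mem _ _ (add_mem
        (I_mem_degreeGE (by omega)) (J_mem_degreeGE (by omega)))))
  · rw [hD, ← smul_lie_H_zero_add_scalingMap, hu']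
    simp only [add_lie, smul_lie]
    abel

/-! ### 2-local derivations -/

section TwoLocal

variable {Δ : PlanarGCA → PlanarGCA}

/-- Pairing `L N` with `L 0` puts its image in degree `N`, pairing it with `L 1` in degree `N + 1`.
-/
theorem twoLocal_L_eq_zero (hΔ : IsTwoLocalDerivation ℂ Δ) (h0 : Δ (L 0) = 0)
    (h1 : Δ (L 1) = 0) (N : ℤ) : Δ (L N) = 0 := by
  classical
  obtain ⟨D, hD, hx⟩ := hΔ (L 0) (L N)
  obtain ⟨D', hD', hx'⟩ := hΔ (L 1) (L N)
  obtain ⟨a, c, d, r, s, h⟩ := exists_of_derivation_L_eq_zero (hD.symm.trans h0)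
  obtain ⟨a', c', d', r', s', h'⟩ := exists_of_derivation_L_eq_zero (hD'.symm.trans h1)
  rw [h] at hx
  rw [h', hx] at hx'
  have eL := congrArg (fun v => basis.repr v (.L, N)) hx'
  have eI := congrArg (fun v => basis.repr v (.I, N)) hx'
  have eJ := congrArg (fun v => basis.repr v (.J, N)) hx'
  simp at eL eI eJ
  rw [hx]
  simp only [add_lie, smul_lie, lie_L_L, lie_I_L, lie_J_L, scalingMap_L, smul_smul]
  rcases eL with eL | eL <;> rcases eI with eI | eI <;> rcases eJ with eJ | eJ <;>
    simp [eL, eI, eJ]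

theorem exists_twoLocal_eq_scalingMap (hΔ : IsTwoLocalDerivation ℂ Δ)
    (hL : ∀ N, Δ (L N) = 0) (x : PlanarGCA) : ∃ r s : ℂ, Δ x = scalingMap r s x := by
  obtain ⟨K, hK⟩ := exists_forall_eq_scalingMap x (Δ x)
  obtain ⟨D, hD, hx⟩ := hΔ (L K) x
  obtain ⟨a, c, d, r, s, h⟩ := exists_of_derivation_L_eq_zero (hD.symm.trans (hL K))
  exact ⟨r, s, hK K le_rfl _ (combination_mem_degreeGE a c d K) r s (hx.trans (h x))⟩

/-- A 2-local derivation that kills every `L N` is a scaling. -/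
theorem twoLocal_eq_scaling (hΔ : IsTwoLocalDerivation ℂ Δ) (hL : ∀ N, Δ (L N) = 0) :
    ∃ r s : ℂ, ∀ x, Δ x = scaling r s x := by
  classical
  have key (N : ℤ) : ∃ r s : ℂ, 0 < N → ∀ x, ∃ u ∈ degreeGE N,
      Δ x = ⁅u, x⁆ + scalingMap r s x := by
    obtain ⟨r, s, h⟩ := exists_twoLocal_eq_scalingMap hΔ hL (L N + I (2 * N) + J (2 * N))
    refine ⟨r, s, fun hN x => ?_⟩
    obtain ⟨D, hD, hx⟩ := hΔ (L N + I (2 * N) + J (2 * N)) x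
    obtain ⟨u, hu, hDu⟩ := exists_of_derivation_eq_scalingMap hN (hD.symm.trans h)
    exact ⟨u, hu, hx.trans (hDu x)⟩
  choose r s h using key
  have large (x : PlanarGCA) : ∃ K : ℤ, ∀ N, K ≤ N → 0 < N →
      Δ x = scalingMap (r N) (s N) x := by
    obtain ⟨K, hK⟩ := exists_forall_eq_scalingMap x (Δ x)
    refine ⟨K, fun N hN hN0 => ?_⟩
    obtain ⟨u, hu, hx⟩ := h N hN0 x
    exact hK N hN u hu _ _ hx
  obtain ⟨K, hK⟩ := large (I 0 + J 0)
  refine ⟨r (max K 1), s (max K 1), fun x => ?_⟩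
  obtain ⟨M, hM⟩ := large x
  -- The factors at `N = max K 1` and at a level large enough for `x` agree, both being read off
  -- from `Δ (I 0 + J 0)`.
  have e := (hK (max K 1) (by omega) (by omega)).symm.trans
    (hK (max M (max K 1)) (by omega) (by omega))
  have er := congrArg (fun v => basis.repr v (.I, 0)) e
  have es := congrArg (fun v => basis.repr v (.J, 0)) e
  simp at er es
  rw [scaling_apply, er, es]
  exact hM _ (by omega) (by omega)

end TwoLocal

end PlanarGCA

theorem IsTwoLocalDerivation.sub_lieDerivation {R 𝔤 : Type*} [CommRing R] [LieRing 𝔤]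
    [LieAlgebra R 𝔤] {Δ : 𝔤 → 𝔤} (hΔ : IsTwoLocalDerivation R Δ) (D : LieDerivation R 𝔤 𝔤) :
    IsTwoLocalDerivation R fun x => Δ x - D x := fun x y => by
  obtain ⟨D', hx, hy⟩ := hΔ x y
  exact ⟨D' - D, by simp [hx], by simp [hy]⟩

theorem theorem3p6 (Δ : PlanarGCA → PlanarGCA) (hΔ : IsTwoLocalDerivation ℂ Δ) :
    ∃ D : LieDerivation ℂ PlanarGCA PlanarGCA, ∀ x : PlanarGCA, Δ x = D x := by
  obtain ⟨D, h0, h1⟩ := hΔ (PlanarGCA.L 0) (PlanarGCA.L 1)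
  have hΔ' := hΔ.sub_lieDerivation D
  obtain ⟨r, s, h⟩ := PlanarGCA.twoLocal_eq_scaling hΔ'
    (PlanarGCA.twoLocal_L_eq_zero hΔ' (sub_eq_zero.mpr h0) (sub_eq_zero.mpr h1))
  exact ⟨D + PlanarGCA.scaling r s, fun x => by
    rw [LieDerivation.add_apply, ← h x]
    abel⟩
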